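/- Let $L^{n+2}$ be Lorentz–Minkowski space with coordinates $(z^0,\dots,z^{n+1})$ and inner product $\langle\ ,\ \rangle$ of signature $(-+\cdots+)$, let $Q^{n+1}_\pm=\{z:\langle z,z\rangle=0,\ \pm z^0>0\}$ be the upper and lower lightcones and $H^{n+1}=\{z:\langle z,z\rangle=-1,\ z^0>0\}$ the hyperbolic space. A $C^\infty$ map $x:M^n\to Q^{n+1}_+$ from an $n$-manifold is called a spacelike front if there is a $C^\infty$ map $y:M^n\to Q^{n+1}_-$ with $\langle x,y\rangle=1$ and $\langle dx,y\rangle=\langle dy,x\rangle=0$ such that $(x,y):M^n\to Q^{n+1}_+\times Q^{n+1}_-$ is an immersion. There exist spacelike fronts in $Q^{n+1}_+$ that are not immersions. More precisely, let $n\ge 3$, let $a,b>0$ with $a^2+b^2=1$, and let $c:S^2\times S^{n-2}\to S^{n+1}\subset\mathbb R^3\times\mathbb R^{n-1}$, $c(u,v)=(au,bv)$, be the corresponding generalized Clifford torus. Then there is a conformal transformation $T$ of $S^{n+1}$ such that $T\circ c$ takes values in the open hemisphere $\{(X',s)\in S^{n+1}: s>0\}$, which is identified with $H^{n+1}$ by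 the conformal diffeomorphism $(X',s)\mapsto \frac1s(1,X')$, and such that the resulting map $f:S^2\times S^{n-2}\to H^{n+1}$ has the following properties: $f$ is an immersion admitting a $C^\infty$ unit normal vector field, and for every $C^\infty$ unit normal vector field $\nu$ of $f$ in $H^{n+1}$ the map $$x=\frac{1}{\sqrt2}\,(f-\nu): S^2\times S^{n-2}\to Q^{n+1}_+$$ is a spacelike front which is not an immersion. -/

import Mathlib

open scoped Manifold ContDiff

/-- The Lorentz-Minkowski space `L^{n+2}`; the Lorentzian form on it is `lorentzForm`. -/
abbrev LorentzSpace (n : ℕ) : Type := Fin (n + 2) → ℝ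

/-- The Lorentzian inner product of signature `(- + ⋯ +)`. -/
def lorentzForm {n : ℕ} (z w : LorentzSpace n) : ℝ :=
  -(z 0 * w 0) + ∑ i : Fin (n + 1), z i.succ * w i.succ

/-- The upper lightcone `Q^{n+1}_+`. -/
def upperLightcone (n : ℕ) : Set (LorentzSpace n) :=
  {z | lorentzForm z z = 0 ∧ 0 < z 0}

/-- The lower lightcone `Q^{n+1}_-`. -/
def lowerLightcone (n : ℕ) : Set (LorentzSpace n) :=
  {z | lorentzForm z z = 0 ∧ z 0 < 0}

/-- The hyperbolic space `H^{n+1}` as a hyperboloid in `L^{n+2}`. -/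
def hyperbolicSpace (n : ℕ) : Set (LorentzSpace n) :=
  {z | lorentzForm z z = -1 ∧ 0 < z 0}

section Fronts

variable {E : Type*} [NormedAddCommGroup E] [NormedSpace ℝ E] {H : Type*} [TopologicalSpace H]
  (I : ModelWithCorners ℝ E H) {M : Type*} [TopologicalSpace M] [ChartedSpace H M]

/-- The differential `dF_p : T_pM → V` of a vector-valued map. -/
noncomputable def differential {V : Type*} [NormedAddCommGroup V] [NormedSpace ℝ V] (F : M → V)
    (p : M) (X : TangentSpace I p) : V :=
  mfderiv I 𝓘(ℝ, V) F p X

/-- A `C^∞` map from a manifold to a vector space (or to an embedded submanifold of it, regarded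
as a map to the ambient space) is an immersion if its differential is injective at every point. -/
def IsSmoothImmersion {V : Type*} [NormedAddCommGroup V] [NormedSpace ℝ V] (F : M → V) : Prop :=
  ContMDiff I 𝓘(ℝ, V) ∞ F ∧
    ∀ p : M, Function.Injective (differential I F p)

/-- `x : M^n → Q^{n+1}_+` is a spacelike frontal on the `n`-manifold `M` with dual
`y : M^n → Q^{n+1}_-`: both maps are `C^∞`, `⟨x, y⟩ = 1` and `⟨dx, y⟩ = ⟨dy, x⟩ = 0`. -/
structure IsSpacelikeFrontalWithDual {n : ℕ} (x y : M → LorentzSpace n) : Prop where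
  dim_eq : Module.finrank ℝ E = n
  smooth_x : ContMDiff I 𝓘(ℝ, LorentzSpace n) ∞ x
  smooth_y : ContMDiff I 𝓘(ℝ, LorentzSpace n) ∞ y
  mem_upper : ∀ p, x p ∈ upperLightcone n
  mem_lower : ∀ p, y p ∈ lowerLightcone n
  pairing : ∀ p, lorentzForm (x p) (y p) = 1
  dx_y : ∀ (p : M) (X : TangentSpace I p),
    lorentzForm (differential I x p X) (y p) = 0
  dy_x : ∀ (p : M) (X : TangentSpace I p),
    lorentzForm (differential I y p X) (x p) = 0

/-- `x : M^n → Q^{n+1}_+` is a spacelike front: it is a spacelike frontal having a dual `y` such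
that `(x, y) : M^n → Q^{n+1}_+ × Q^{n+1}_-` is an immersion. -/
def IsSpacelikeFront {n : ℕ} (x : M → LorentzSpace n) : Prop :=
  ∃ y : M → LorentzSpace n, IsSpacelikeFrontalWithDual I x y ∧
    IsSmoothImmersion I (fun p => (x p, y p))

/-- `ν` is a unit normal vector field along `f : M → H^{n+1}`: a `C^∞` field of unit vectors
tangent to `H^{n+1}` (that is, orthogonal to the position vector `f`) and orthogonal to `df`. -/
structure IsUnitNormalField {n : ℕ} (f ν : M → LorentzSpace n) : Prop where
  smooth : ContMDiff I 𝓘(ℝ, LorentzSpace n) ∞ ν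
  tangent : ∀ p, lorentzForm (ν p) (f p) = 0
  unit : ∀ p, lorentzForm (ν p) (ν p) = 1
  normal : ∀ (p : M) (X : TangentSpace I p),
    lorentzForm (differential I f p X) (ν p) = 0

end Fronts

/-- The unit sphere `S^k` in `ℝ^{k+1}`. -/
abbrev UnitSphere (k : ℕ) : Type := Metric.sphere (0 : EuclideanSpace ℝ (Fin (k + 1))) 1

/-- A diffeomorphism `T` of `S^k` is a conformal transformation if at each point it multiplies the
round metric (the one induced by the inclusion in `ℝ^{k+1}`) by a positive factor. -/
def IsConformalTransformation {k : ℕ}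
    (T : Diffeomorph (𝓡 k) (𝓡 k) (UnitSphere k) (UnitSphere k) ∞) : Prop :=
  ∀ p : UnitSphere k, ∃ c : ℝ, 0 < c ∧ ∀ X Y : TangentSpace (𝓡 k) p,
    inner ℝ (differential (𝓡 k) (fun q => (T q : EuclideanSpace ℝ (Fin (k + 1)))) p X)
        (differential (𝓡 k) (fun q => (T q : EuclideanSpace ℝ (Fin (k + 1)))) p Y)
      = c * inner ℝ
        (differential (𝓡 k) (fun q : UnitSphere k => (q : EuclideanSpace ℝ (Fin (k + 1)))) p X)
        (differential (𝓡 k) (fun q : UnitSphere k => (q : EuclideanSpace ℝ (Fin (k + 1)))) p Y)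

/-- The vector `(a u, b v)` of `ℝ^{n+2} = ℝ^3 × ℝ^{n-1}`. -/
noncomputable def cliffordVector {n : ℕ} (a b : ℝ) (u : EuclideanSpace ℝ (Fin 3))
    (v : EuclideanSpace ℝ (Fin (n - 2 + 1))) : EuclideanSpace ℝ (Fin (n + 1 + 1)) :=
  WithLp.toLp 2 fun i => if h : (i : ℕ) < 3 then a * u ⟨i, h⟩
    else b * v ⟨i - 3, by have := i.isLt; omega⟩

theorem cliffordVector_mem_sphere {n : ℕ} (hn : 3 ≤ n) {a b : ℝ} (hab : a ^ 2 + b ^ 2 = 1)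
    (u : UnitSphere 2) (v : UnitSphere (n - 2)) :
    cliffordVector (n := n) a b u v ∈ Metric.sphere (0 : EuclideanSpace ℝ (Fin (n + 1 + 1))) 1 := by
  obtain ⟨m, rfl⟩ : ∃ m, n = m + 2 := ⟨n - 2, by omega⟩
  have hu : ∑ i, (u : EuclideanSpace ℝ (Fin 3)) i ^ 2 = 1 := by
    have := u.2
    rw [mem_sphere_zero_iff_norm] at this
    rw [← EuclideanSpace.real_norm_sq_eq, this, one_pow]
  have hv : ∑ i, (v : EuclideanSpace ℝ (Fin (m + 2 - 2 + 1))) i ^ 2 = 1 := by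
    have := v.2
    rw [mem_sphere_zero_iff_norm] at this
    rw [← EuclideanSpace.real_norm_sq_eq, this, one_pow]
  rw [mem_sphere_zero_iff_norm]
  have key : ‖cliffordVector (n := m + 2) a b u v‖ ^ 2 = 1 := by
    rw [EuclideanSpace.real_norm_sq_eq]
    have e : 3 + (m + 1) = m + 2 + 1 + 1 := by omega
    rw [← (finCongr e).sum_comp, Fin.sum_univ_add]
    have h1 : ∀ i : Fin 3, cliffordVector (n := m + 2) a b u v (finCongr e (Fin.castAdd (m + 1) i))
        = a * (u : EuclideanSpace ℝ (Fin 3)) i := by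
      intro i; simp [cliffordVector]
    have h2 : ∀ i : Fin (m + 1), cliffordVector (n := m + 2) a b u v (finCongr e (Fin.natAdd 3 i))
        = b * (v : EuclideanSpace ℝ (Fin (m + 2 - 2 + 1))) i := by
      intro i; simp [cliffordVector]
    simp only [h1, h2, mul_pow, ← Finset.mul_sum]
    rw [hu]
    have hv' : ∑ i : Fin (m + 1), (v : EuclideanSpace ℝ (Fin (m + 2 - 2 + 1))) i ^ 2 = 1 := hv
    rw [hv', mul_one, mul_one, hab]
  nlinarith [norm_nonneg (cliffordVector (n := m + 2) a b u v)]

/-- The generalized Clifford torus `S^2 × S^{n-2} → S^{n+1}`, `(u, v) ↦ (a u, b v)`. -/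
noncomputable def cliffordTorus {n : ℕ} (hn : 3 ≤ n) {a b : ℝ} (hab : a ^ 2 + b ^ 2 = 1)
    (p : UnitSphere 2 × UnitSphere (n - 2)) : UnitSphere (n + 1) :=
  ⟨cliffordVector (n := n) a b p.1 p.2, cliffordVector_mem_sphere hn hab p.1 p.2⟩

/-- The open hemisphere of `S^{n+1}` on which the last coordinate is positive. -/
def openHemisphere (n : ℕ) : Set (UnitSphere (n + 1)) :=
  {X | 0 < (X : EuclideanSpace ℝ (Fin (n + 1 + 1))) (Fin.last (n + 1))}

/-- The conformal identification of the open hemisphere with `H^{n+1}`,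
`(X', s) ↦ (1, X') / s` (only used for `s > 0`). -/
noncomputable def hemisphereToHyperbolic {n : ℕ} (X : UnitSphere (n + 1)) : LorentzSpace n :=
  Fin.cons (1 / (X : EuclideanSpace ℝ (Fin (n + 1 + 1))) (Fin.last (n + 1)))
    (fun j : Fin (n + 1) => (X : EuclideanSpace ℝ (Fin (n + 1 + 1))) j.castSucc /
      (X : EuclideanSpace ℝ (Fin (n + 1 + 1))) (Fin.last (n + 1)))

theorem hemisphereToHyperbolic_mem {n : ℕ} {X : UnitSphere (n + 1)} (hX : X ∈ openHemisphere n) :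
    hemisphereToHyperbolic X ∈ hyperbolicSpace n := by
  have hs : 0 < (X : EuclideanSpace ℝ (Fin (n + 1 + 1))) (Fin.last (n + 1)) := hX
  have hn : ∑ i, (X : EuclideanSpace ℝ (Fin (n + 1 + 1))) i ^ 2 = 1 := by
    have := X.2
    rw [mem_sphere_zero_iff_norm] at this
    rw [← EuclideanSpace.real_norm_sq_eq, this, one_pow]
  rw [Fin.sum_univ_castSucc] at hn
  refine ⟨?_, ?_⟩
  · have h2 : ∀ j : Fin (n + 1), hemisphereToHyperbolic X j.succ * hemisphereToHyperbolic X j.succ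
        = (X : EuclideanSpace ℝ (Fin (n + 1 + 1))) j.castSucc ^ 2 *
          (1 / (X : EuclideanSpace ℝ (Fin (n + 1 + 1))) (Fin.last (n + 1)) ^ 2) := by
      intro j
      simp only [hemisphereToHyperbolic, Fin.cons_succ]
      field_simp
    have h0 : hemisphereToHyperbolic X 0
        = 1 / (X : EuclideanSpace ℝ (Fin (n + 1 + 1))) (Fin.last (n + 1)) := rfl
    simp only [lorentzForm, h2, h0, ← Finset.sum_mul]
    rw [eq_sub_of_add_eq hn]
    field_simp
    ring
  · show 0 < 1 / (X : EuclideanSpace ℝ (Fin (n + 1 + 1))) (Fin.last (n + 1))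
    positivity

/-! With `y = -(f + ν)/√2` every condition on a dual follows by differentiating the constant
pairings of `f` and `ν`. Since `x - y = √2 f`, the pair `(x, y)` is an immersion because `f` is. So
any immersed hypersurface of hyperbolic space with a unit normal gives a front
(`IsUnitNormalField.isSpacelikeFront`), and `x` fails to be an immersion where a principal curvature
makes `d(f - ν)` degenerate.

`T` is a Lorentz boost acting on the sphere, with axis the last coordinate and hyperbolic cosine `q`
and sine `μ`; `q * a = 2` puts the whole torus in the open hemisphere. The last coordinate involves
only the factor `S^{n-2}`. Hence, writing `y` now for the last coordinate of `v`, on each slice `S^2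
× {v}` the `S^2` directions are principal with constant curvature `κ = (bμ + qy)/a`, where `dν₀ = -κ
df` for the explicit normal `ν₀`. By Cauchy–Schwarz some `y` in `[-1, 1]` gives `κ = -ε`, for either
sign `ε` (`exists_slice`), and then `f - εν₀` is constant on the slice
(`boostedHypersurface_sub_boostedNormal_slice`).

The domain is connected, so an arbitrary unit normal is `ν₀` or `-ν₀`
(`IsUnitNormalField.eq_or_eq_neg`); both signs of `ε` being available, every choice is covered. -/

/-! ### Algebra of the Lorentzian form. -/

section Lorentz

variable {n : ℕ}

/-- The Lorentzian inner product as a continuous bilinear map. -/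
noncomputable def lorentzBilin (n : ℕ) : LorentzSpace n →L[ℝ] LorentzSpace n →L[ℝ] ℝ :=
  (LinearMap.mk₂ ℝ (lorentzForm (n := n))
    (fun x y z => by simp only [lorentzForm, Pi.add_apply, add_mul, Finset.sum_add_distrib]; ring)
    (fun c x y => by
      simp only [lorentzForm, Pi.smul_apply, smul_eq_mul, mul_assoc, ← Finset.mul_sum]; ring)
    (fun x y z => by simp only [lorentzForm, Pi.add_apply, mul_add, Finset.sum_add_distrib]; ring)
    (fun c x y => by
      simp only [lorentzForm, Pi.smul_apply, smul_eq_mul, mul_left_comm _ c, ← Finset.mul_sum]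
      ring)).toContinuousBilinearMap

theorem lorentzBilin_apply (z w : LorentzSpace n) : lorentzBilin n z w = lorentzForm z w := rfl

theorem lorentzForm_comm (z w : LorentzSpace n) : lorentzForm z w = lorentzForm w z := by
  simp only [lorentzForm, mul_comm]

theorem lorentzForm_add_left (z z' w : LorentzSpace n) :
    lorentzForm (z + z') w = lorentzForm z w + lorentzForm z' w := by
  simp [← lorentzBilin_apply]

theorem lorentzForm_sub_left (z z' w : LorentzSpace n) :
    lorentzForm (z - z') w = lorentzForm z w - lorentzForm z' w := by
  simp [← lorentzBilin_apply]

theorem lorentzForm_smul_left (c : ℝ) (z w : LorentzSpace n) :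
    lorentzForm (c • z) w = c * lorentzForm z w := by
  simp [← lorentzBilin_apply]

theorem lorentzForm_add_right (z w w' : LorentzSpace n) :
    lorentzForm z (w + w') = lorentzForm z w + lorentzForm z w' := by
  simp [← lorentzBilin_apply]

theorem lorentzForm_sub_right (z w w' : LorentzSpace n) :
    lorentzForm z (w - w') = lorentzForm z w - lorentzForm z w' := by
  simp [← lorentzBilin_apply]

theorem lorentzForm_smul_right (c : ℝ) (z w : LorentzSpace n) :
    lorentzForm z (c • w) = c * lorentzForm z w := by
  simp [← lorentzBilin_apply]

theorem eq_zero_of_lorentzForm_eq_zero {w : LorentzSpace n} (h : ∀ z, lorentzForm z w = 0) :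
    w = 0 := by
  have h0 := h (Pi.single 0 1)
  have hs : ∀ i : Fin (n + 1), w i.succ = 0 := fun i => by
    have := h (Pi.single i.succ 1)
    simpa [lorentzForm, Pi.single_apply] using this
  have h0' : w 0 = 0 := by simpa [lorentzForm, Pi.single_apply] using h0
  funext i
  exact Fin.cases h0' hs i

/-- Cauchy–Schwarz on the spatial parts gives `ν₀² + 1 ≤ f₀²` for the time components. This fixes
the time orientation of `f - ν` and `-(f + ν)`. -/
theorem sq_lt_sq_of_mem_hyperbolicSpace {f ν : LorentzSpace n} (hf : lorentzForm f f = -1)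
    (hfν : lorentzForm ν f = 0) (hν : lorentzForm ν ν = 1) : ν 0 ^ 2 < f 0 ^ 2 := by
  simp only [lorentzForm] at hf hfν hν
  have cs := Finset.sum_mul_sq_le_sq_mul_sq Finset.univ (fun i : Fin (n + 1) => ν i.succ)
    (fun i : Fin (n + 1) => f i.succ)
  simp only [pow_two (ν _), pow_two (f _)] at cs
  rw [show ∑ i : Fin (n + 1), ν i.succ * f i.succ = ν 0 * f 0 by linarith,
    show ∑ i : Fin (n + 1), ν i.succ * ν i.succ = 1 + ν 0 * ν 0 by linarith,
    show ∑ i : Fin (n + 1), f i.succ * f i.succ = f 0 * f 0 - 1 by linarith] at cs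
  nlinarith [sq_nonneg (ν 0)]

end Lorentz

/-! ### Calculus of vector-valued maps on manifolds. -/

section Differential

variable {E : Type*} [NormedAddCommGroup E] [NormedSpace ℝ E] {H : Type*} [TopologicalSpace H]
  {I : ModelWithCorners ℝ E H} {M : Type*} [TopologicalSpace M] [ChartedSpace H M]
  {V : Type*} [NormedAddCommGroup V] [NormedSpace ℝ V]
  {W : Type*} [NormedAddCommGroup W] [NormedSpace ℝ W]

theorem differential_comp {G : V → W} {F : M → V} {p : M} {G' : V →L[ℝ] W}
    (hG : HasFDerivAt G G' (F p)) (hF : MDifferentiableAt I 𝓘(ℝ, V) F p) (X : TangentSpace I p) :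
    differential I (fun q => G (F q)) p X = G' (differential I F p X) := by
  have := (HasMFDerivAt.comp p (HasFDerivAt.hasMFDerivAt hG) hF.hasMFDerivAt).mfderiv
  exact congrArg (fun L : E →L[ℝ] W => L X) this

theorem differential_prodMk {F : M → V} {G : M → W} {p : M}
    (hF : MDifferentiableAt I 𝓘(ℝ, V) F p) (hG : MDifferentiableAt I 𝓘(ℝ, W) G p)
    (X : TangentSpace I p) :
    differential I (fun q => (F q, G q)) p X = (differential I F p X, differential I G p X) := by
  have h := hF.prodMk_space hG
  refine Prod.ext ?_ ?_
  · exact (differential_comp (hasFDerivAt_fst (𝕜 := ℝ)) h X).symm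
  · exact (differential_comp (hasFDerivAt_snd (𝕜 := ℝ)) h X).symm

theorem differential_clm (L : V →L[ℝ] W) {F : M → V} {p : M}
    (hF : MDifferentiableAt I 𝓘(ℝ, V) F p) (X : TangentSpace I p) :
    differential I (fun q => L (F q)) p X = L (differential I F p X) :=
  differential_comp L.hasFDerivAt hF X

theorem differential_bilin {Z : Type*} [NormedAddCommGroup Z] [NormedSpace ℝ Z]
    (B : V →L[ℝ] W →L[ℝ] Z) {F : M → V} {G : M → W} {p : M}
    (hF : MDifferentiableAt I 𝓘(ℝ, V) F p) (hG : MDifferentiableAt I 𝓘(ℝ, W) G p)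
    (X : TangentSpace I p) :
    differential I (fun q => B (F q) (G q)) p X =
      B (F p) (differential I G p X) + B (differential I F p X) (G p) := by
  have h := hF.prodMk_space hG
  have hB := B.hasFDerivAt_of_bilinear (hasFDerivAt_fst (𝕜 := ℝ) (p := (F p, G p)))
    (hasFDerivAt_snd (𝕜 := ℝ) (p := (F p, G p)))
  rw [differential_comp (G := fun w : V × W => B w.1 w.2) (F := fun q => (F q, G q)) hB h X,
    differential_prodMk hF hG]
  simp

theorem differential_zero (F : M → V) (p : M) : differential I F p 0 = 0 :=
  map_zero (mfderiv I 𝓘(ℝ, V) F p)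

theorem differential_const (c : V) (p : M) (X : TangentSpace I p) :
    differential I (fun _ : M => c) p X = 0 := by
  simp only [differential, mfderiv_const]; rfl

/-- Source of all orthogonality relations among `f`, `ν`, `df` and `dν`. -/
theorem differential_lorentzForm {n : ℕ} {F G : M → LorentzSpace n} {p : M}
    (hF : MDifferentiableAt I 𝓘(ℝ, LorentzSpace n) F p)
    (hG : MDifferentiableAt I 𝓘(ℝ, LorentzSpace n) G p) {c : ℝ}
    (hc : ∀ q, lorentzForm (F q) (G q) = c) (X : TangentSpace I p) :
    lorentzForm (F p) (differential I G p X) + lorentzForm (differential I F p X) (G p) = 0 := by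
  have h := differential_bilin (lorentzBilin n) hF hG X
  simp only [lorentzBilin_apply, hc] at h
  rw [← h, differential_const]

end Differential

/-! ### Fronts from hypersurfaces, and uniqueness of the unit normal. -/

section Normals

variable {E : Type*} [NormedAddCommGroup E] [NormedSpace ℝ E] {H : Type*} [TopologicalSpace H]
  {I : ModelWithCorners ℝ E H} {M : Type*} [TopologicalSpace M] [ChartedSpace H M] {n : ℕ}
  {f ν : M → LorentzSpace n}

/-- The map `(f - ν) / √2` associated with an immersed hypersurface `f` of `H^{n+1}` with unit
normal `ν` is a spacelike front, with dual `-(f + ν) / √2`. -/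
theorem IsUnitNormalField.isSpacelikeFront (hdim : Module.finrank ℝ E = n)
    (hf : IsSmoothImmersion I f) (hfH : ∀ p, f p ∈ hyperbolicSpace n)
    (hν : IsUnitNormalField I f ν) :
    IsSpacelikeFront I (fun p => (1 / Real.sqrt 2) • (f p - ν p)) := by
  have hfd : MDifferentiable I 𝓘(ℝ, LorentzSpace n) f := hf.1.mdifferentiable (by simp)
  have hνd : MDifferentiable I 𝓘(ℝ, LorentzSpace n) ν := hν.smooth.mdifferentiable (by simp)
  set r : ℝ := 1 / Real.sqrt 2 with hr
  have hr0 : 0 < r := by positivity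
  -- The scale is forced by the pairing: `⟨x, y⟩ = -r²(⟨f, f⟩ - ⟨ν, ν⟩) = 2r²`.
  have hr2 : r * r = 1 / 2 := by
    rw [hr, div_mul_div_comm, Real.mul_self_sqrt (by norm_num)]; norm_num
  have hx : ContMDiff I 𝓘(ℝ, LorentzSpace n) ∞ (fun p => r • (f p - ν p)) :=
    (contMDiff_const (I' := 𝓘(ℝ, ℝ)) (c := r)).smul (hf.1.sub hν.smooth)
  have hy : ContMDiff I 𝓘(ℝ, LorentzSpace n) ∞ (fun p => (-r) • (f p + ν p)) :=
    (contMDiff_const (I' := 𝓘(ℝ, ℝ)) (c := -r)).smul (hf.1.add hν.smooth)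
  have dx : ∀ p (X : TangentSpace I p), differential I (fun p => r • (f p - ν p)) p X
      = r • (differential I f p X - differential I ν p X) := fun p X => by
    have := differential_clm (r • (ContinuousLinearMap.fst ℝ (LorentzSpace n) (LorentzSpace n) -
      ContinuousLinearMap.snd ℝ _ _)) ((hfd p).prodMk_space (hνd p)) X
    rw [differential_prodMk (hfd p) (hνd p)] at this
    exact this
  have dy : ∀ p (X : TangentSpace I p), differential I (fun p => (-r) • (f p + ν p)) p X
      = (-r) • (differential I f p X + differential I ν p X) := fun p X => by
    have := differential_clm ((-r) • (ContinuousLinearMap.fst ℝ (LorentzSpace n) (LorentzSpace n) +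
      ContinuousLinearMap.snd ℝ _ _)) ((hfd p).prodMk_space (hνd p)) X
    rw [differential_prodMk (hfd p) (hνd p)] at this
    exact this
  have e1 : ∀ p (X : TangentSpace I p), lorentzForm (differential I f p X) (f p) = 0 :=
    fun p X => by
      have := differential_lorentzForm (hfd p) (hfd p) (fun q => (hfH q).1) X
      rw [lorentzForm_comm (f p)] at this
      linarith
  have e2 : ∀ p (X : TangentSpace I p), lorentzForm (differential I ν p X) (ν p) = 0 :=
    fun p X => by
      have := differential_lorentzForm (hνd p) (hνd p) hν.unit X
      rw [lorentzForm_comm (ν p)] at this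
      linarith
  have e3 : ∀ p (X : TangentSpace I p), lorentzForm (differential I ν p X) (f p) = 0 :=
    fun p X => by
      have := differential_lorentzForm (hνd p) (hfd p) hν.tangent X
      rw [lorentzForm_comm (ν p), hν.normal] at this
      linarith
  have habs : ∀ p, |ν p 0| < f p 0 := fun p =>
    abs_lt_of_sq_lt_sq (sq_lt_sq_of_mem_hyperbolicSpace (hfH p).1 (hν.tangent p) (hν.unit p))
      (hfH p).2.le
  have e4 : ∀ p, lorentzForm (f p) (ν p) = 0 := fun p => by rw [lorentzForm_comm, hν.tangent]
  refine ⟨fun p => (-r) • (f p + ν p), ⟨hdim, hx, hy, fun p => ⟨?_, ?_⟩, fun p => ⟨?_, ?_⟩,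
    fun p => ?_, fun p X => ?_, fun p X => ?_⟩, hx.prodMk_space hy, fun p X Y hXY => ?_⟩
  · simp only [lorentzForm_smul_left, lorentzForm_smul_right, lorentzForm_sub_left,
      lorentzForm_sub_right, (hfH p).1, hν.tangent, hν.unit, e4]
    ring
  · have := (abs_lt.1 (habs p)).2
    simp only [Pi.smul_apply, Pi.sub_apply, smul_eq_mul]
    exact mul_pos hr0 (by linarith)
  · simp only [lorentzForm_smul_left, lorentzForm_smul_right, lorentzForm_add_left,
      lorentzForm_add_right, (hfH p).1, hν.tangent, hν.unit, e4]
    ring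
  · have := (abs_lt.1 (habs p)).1
    simp only [Pi.smul_apply, Pi.add_apply, smul_eq_mul]
    exact mul_neg_of_neg_of_pos (by linarith) (by linarith)
  · simp only [lorentzForm_smul_left, lorentzForm_smul_right, lorentzForm_sub_left,
      lorentzForm_add_right, (hfH p).1, hν.tangent, hν.unit, e4]
    linarith
  · rw [dx]
    simp only [lorentzForm_smul_left, lorentzForm_smul_right, lorentzForm_sub_left,
      lorentzForm_add_right, e1, e2, e3, hν.normal]
    ring
  · rw [dy]
    simp only [lorentzForm_smul_left, lorentzForm_smul_right, lorentzForm_add_left,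
      lorentzForm_sub_right, e1, e2, e3, hν.normal]
    ring
  · refine hf.2 p ?_
    have hxd := hx.mdifferentiable (by simp) p
    have hyd := hy.mdifferentiable (by simp) p
    rw [differential_prodMk hxd hyd, differential_prodMk hxd hyd, dx, dx, dy, dy,
      Prod.mk.injEq] at hXY
    -- Subtracting the components cancels `dν` and leaves `2r df`.
    have h := congrArg₂ (· - ·) hXY.1 hXY.2
    have h2 : (2 * r) • differential I f p X = (2 * r) • differential I f p Y := by
      refine Eq.trans ?_ (h.trans ?_) <;> module
    exact smul_right_injective _ (by positivity : (2 * r) ≠ 0) h2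

/-- Two unit normals of an immersed hypersurface of `H^{n+1}` at a point are proportional. -/
theorem IsUnitNormalField.eq_smul [FiniteDimensional ℝ E] (hdim : Module.finrank ℝ E = n)
    (hf : IsSmoothImmersion I f) (hfH : ∀ p, f p ∈ hyperbolicSpace n)
    (hν : IsUnitNormalField I f ν) {ν' : M → LorentzSpace n} (hν' : IsUnitNormalField I f ν')
    (p : M) : ν' p = lorentzForm (ν' p) (ν p) • ν p := by
  have hfd : MDifferentiable I 𝓘(ℝ, LorentzSpace n) f := hf.1.mdifferentiable (by simp)
  have e1 : ∀ X : TangentSpace I p, lorentzForm (differential I f p X) (f p) = 0 := fun X => by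
    have := differential_lorentzForm (hfd p) (hfd p) (fun q => (hfH q).1) X
    rw [lorentzForm_comm (f p)] at this
    linarith
  have e4 : lorentzForm (f p) (ν p) = 0 := by rw [lorentzForm_comm, hν.tangent]
  have e5 : lorentzForm (f p) (ν' p) = 0 := by rw [lorentzForm_comm, hν'.tangent]
  let D : E →ₗ[ℝ] LorentzSpace n := (mfderiv I 𝓘(ℝ, LorentzSpace n) f p).toLinearMap
  have hD : ∀ X : E, D X = differential I f p X := fun _ => rfl
  have hDinj : ∀ X : E, D X = 0 → X = 0 := fun X hX =>
    hf.2 p (hX.trans (differential_zero f p).symm)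
  -- Tangent space, position and normal together span: pairing with `f` and `ν` shows `Φ` injective,
  -- and both sides have dimension `n + 2`. By nondegeneracy the claim can then be tested on the
  -- image of `Φ`.
  let Φ : (E × ℝ × ℝ) →ₗ[ℝ] LorentzSpace n := D.coprod
    ((LinearMap.toSpanSingleton ℝ _ (f p)).coprod (LinearMap.toSpanSingleton ℝ _ (ν p)))
  have hΦ : ∀ w, Φ w = differential I f p w.1 + (w.2.1 • f p + w.2.2 • ν p) := fun _ => rfl
  have hinj : Function.Injective Φ := by
    rw [← LinearMap.ker_eq_bot, LinearMap.ker_eq_bot']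
    rintro ⟨X, s, t⟩ h
    rw [hΦ] at h
    have hs := congrArg (lorentzForm · (f p)) h
    have ht := congrArg (lorentzForm · (ν p)) h
    have hz : ∀ w, lorentzForm (0 : LorentzSpace n) w = 0 := fun w => by
      simp [← lorentzBilin_apply]
    simp only [lorentzForm_add_left, lorentzForm_smul_left, hν.tangent, hν.unit,
      (hfH p).1, e4, hz] at hs ht
    rw [e1 X] at hs
    rw [hν.normal p X] at ht
    have hs' : s = 0 := by linarith
    have ht' : t = 0 := by linarith
    subst hs' ht'
    have : X = 0 := hDinj X (by simpa [hD] using h)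
    simp [this]
  have hsurj : Function.Surjective Φ := by
    refine (LinearMap.injective_iff_surjective_of_finrank_eq_finrank ?_).1 hinj
    simp [hdim]
  rw [← sub_eq_zero]
  refine eq_zero_of_lorentzForm_eq_zero fun z => ?_
  obtain ⟨w, rfl⟩ := hsurj z
  simp only [hΦ, lorentzForm_add_left, lorentzForm_smul_left, lorentzForm_sub_right,
    lorentzForm_smul_right, e4, e5, hν.unit, lorentzForm_comm (ν' p)]
  rw [hν.normal p w.1, hν'.normal p w.1]
  ring

/-- On a connected manifold the unit normal field is unique up to a global sign. -/
theorem IsUnitNormalField.eq_or_eq_neg [PreconnectedSpace M] [FiniteDimensional ℝ E]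
    (hdim : Module.finrank ℝ E = n)
    (hf : IsSmoothImmersion I f) (hfH : ∀ p, f p ∈ hyperbolicSpace n)
    (hν : IsUnitNormalField I f ν) {ν' : M → LorentzSpace n} (hν' : IsUnitNormalField I f ν') :
    (∀ p, ν' p = ν p) ∨ ∀ p, ν' p = -ν p := by
  have key := hν.eq_smul hdim hf hfH hν'
  have hcont : Continuous fun p => lorentzForm (ν' p) (ν p) := by
    have h1 := hν'.smooth.continuous
    have h2 := hν.smooth.continuous
    simp only [lorentzForm]
    fun_prop
  have hsq : ∀ p, lorentzForm (ν' p) (ν p) ^ 2 = 1 := fun p => by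
    have h := hν'.unit p
    rw [key p] at h
    simp only [lorentzForm_smul_left, lorentzForm_smul_right, hν.unit] at h
    linarith
  -- The proportionality factor is continuous with square `1`, hence a constant sign.
  rcases isPreconnected_univ.eq_or_eq_neg_of_sq_eq (g := fun _ : M => (1 : ℝ)) hcont.continuousOn
    continuousOn_const (fun p _ => by simp [hsq p]) (fun _ => one_ne_zero) with h | h
  · left; intro p
    have : lorentzForm (ν' p) (ν p) = 1 := h (Set.mem_univ p)
    rw [key p, this, one_smul]
  · right; intro p
    have : lorentzForm (ν' p) (ν p) = -1 := h (Set.mem_univ p)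
    rw [key p, this, neg_one_smul]

end Normals

/-! ### Quotient rule and tangency to the unit sphere. -/

section DifferentialRules

variable {E : Type*} [NormedAddCommGroup E] [NormedSpace ℝ E] {H : Type*} [TopologicalSpace H]
  {I : ModelWithCorners ℝ E H} {M : Type*} [TopologicalSpace M] [ChartedSpace H M]
  {V : Type*} [NormedAddCommGroup V] [NormedSpace ℝ V]

theorem differential_inv_smul {D : M → ℝ} {B : M → V} {p : M}
    (hD : MDifferentiableAt I 𝓘(ℝ, ℝ) D p) (hB : MDifferentiableAt I 𝓘(ℝ, V) B p)
    (h0 : D p ≠ 0) (X : TangentSpace I p) :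
    differential I (fun q => (D q)⁻¹ • B q) p X =
      (D p)⁻¹ • differential I B p X - ((D p)⁻¹ ^ 2 * differential I D p X) • B p := by
  have hi : MDifferentiableAt I 𝓘(ℝ, ℝ) (fun q => (D q)⁻¹) p :=
    MDifferentiableAt.comp p (I' := 𝓘(ℝ, ℝ)) (g := fun t : ℝ => t⁻¹)
      (differentiableAt_inv h0).mdifferentiableAt hD
  have h := differential_bilin (ContinuousLinearMap.lsmul ℝ ℝ : ℝ →L[ℝ] V →L[ℝ] V) hi hB X
  rw [differential_comp (hasFDerivAt_inv h0) hD] at h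
  simp only [ContinuousLinearMap.lsmul_apply] at h
  rw [h, sub_eq_add_neg, ← neg_smul]
  congr 2
  simp
  ring

theorem inner_differential_self_eq_zero {V : Type*} [NormedAddCommGroup V] [InnerProductSpace ℝ V]
    {F : M → V} {p : M} (hF : MDifferentiableAt I 𝓘(ℝ, V) F p) (h1 : ∀ q, ‖F q‖ = 1)
    (X : TangentSpace I p) : inner ℝ (F p) (differential I F p X) = 0 := by
  have h := differential_bilin (innerSL ℝ : V →L[ℝ] V →L[ℝ] ℝ) hF hF X
  have hc : ∀ q, innerSL ℝ (F q) (F q) = 1 := fun q => by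
    rw [innerSL_apply_apply, real_inner_self_eq_norm_sq, h1, one_pow]
  simp only [hc] at h
  rw [differential_const] at h
  have h2 : 0 = inner ℝ (F p) (differential I F p X) + inner ℝ (differential I F p X) (F p) := h
  rw [real_inner_comm (F p)] at h2
  linarith

end DifferentialRules

/-! ### Smooth structure of the unit sphere seen from the ambient space. -/

section Sphere

theorem contMDiff_coe_unitSphere {k : ℕ} : ContMDiff (𝓡 k) 𝓘(ℝ, EuclideanSpace ℝ (Fin (k + 1))) ∞
    (fun p : UnitSphere k => (p : EuclideanSpace ℝ (Fin (k + 1)))) :=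
  haveI : Fact (Module.finrank ℝ (EuclideanSpace ℝ (Fin (k + 1))) = k + 1) :=
    ⟨finrank_euclideanSpace_fin⟩
  contMDiff_coe_sphere

theorem injective_differential_coe_unitSphere {k : ℕ} (p : UnitSphere k) :
    Function.Injective (differential (𝓡 k)
      (fun p : UnitSphere k => (p : EuclideanSpace ℝ (Fin (k + 1)))) p) :=
  haveI : Fact (Module.finrank ℝ (EuclideanSpace ℝ (Fin (k + 1))) = k + 1) :=
    ⟨finrank_euclideanSpace_fin⟩
  injective_mvfderiv_subtypeVal_sphere p

theorem contMDiff_unitSphere_of_coe {k : ℕ} {F : UnitSphere k → UnitSphere k}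
    (hF : ContMDiff (𝓡 k) 𝓘(ℝ, EuclideanSpace ℝ (Fin (k + 1))) ∞
      (fun p => (F p : EuclideanSpace ℝ (Fin (k + 1))))) : ContMDiff (𝓡 k) (𝓡 k) ∞ F :=
  haveI : Fact (Module.finrank ℝ (EuclideanSpace ℝ (Fin (k + 1))) = k + 1) :=
    ⟨finrank_euclideanSpace_fin⟩
  hF.codRestrict_sphere fun p => (F p).2

end Sphere

/-! ### Möbius transformations of the sphere induced by Lorentz boosts. -/

section Boost

variable {V : Type*} [NormedAddCommGroup V] [InnerProductSpace ℝ V]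

/-- The numerator of the Möbius transformation `sphereBoost`. -/
noncomputable def boostNumerator (μ q : ℝ) (e X : V) : V :=
  X + (μ + (q - 1) * inner ℝ e X) • e

/-- The Möbius transformation of the unit sphere induced by the Lorentz boost in the direction
`e` with hyperbolic sine `μ` and hyperbolic cosine `q`. -/
noncomputable def sphereBoost (μ q : ℝ) (e X : V) : V :=
  (q + μ * inner ℝ e X)⁻¹ • boostNumerator μ q e X

variable {μ q : ℝ} {e X : V}

theorem boost_denominator_pos (hq : 0 < q) (hμ : q ^ 2 = 1 + μ ^ 2) (he : ‖e‖ = 1)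
    (hX : ‖X‖ = 1) : 0 < q + μ * inner ℝ e X := by
  have h1 : |inner ℝ e X| ≤ 1 := by simpa [he, hX] using abs_real_inner_le_norm e X
  have h2 : |μ| < q := abs_lt_of_sq_lt_sq (by linarith) hq.le
  have h3 : |μ * inner ℝ e X| ≤ |μ| := by
    rw [abs_mul]; exact mul_le_of_le_one_right (abs_nonneg _) h1
  linarith [neg_abs_le (μ * inner ℝ e X)]

theorem inner_boostNumerator (he : ‖e‖ = 1) :
    inner ℝ e (boostNumerator μ q e X) = μ + q * inner ℝ e X := by
  simp only [boostNumerator, inner_add_right, real_inner_smul_right, real_inner_self_eq_norm_sq, he]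
  ring

/-- The boost sends the null vector `(1, X)` to the null vector (denominator, numerator), so the
quotient is a unit vector. -/
theorem norm_sphereBoost (hq : 0 < q) (hμ : q ^ 2 = 1 + μ ^ 2) (he : ‖e‖ = 1)
    (hX : ‖X‖ = 1) : ‖sphereBoost μ q e X‖ = 1 := by
  have hD := boost_denominator_pos hq hμ he hX
  have hee : inner ℝ e e = 1 := by rw [real_inner_self_eq_norm_sq, he, one_pow]
  have hXX : inner ℝ X X = 1 := by rw [real_inner_self_eq_norm_sq, hX, one_pow]
  have h : ‖boostNumerator μ q e X‖ ^ 2 = (q + μ * inner ℝ e X) ^ 2 := by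
    rw [← real_inner_self_eq_norm_sq]
    simp only [boostNumerator, inner_add_left, inner_add_right, real_inner_smul_left,
      real_inner_smul_right, hee, hXX, real_inner_comm e X]
    linear_combination (inner ℝ e X ^ 2 - 1) * hμ
  rw [sphereBoost, norm_smul, norm_inv, Real.norm_of_nonneg hD.le,
    (sq_eq_sq₀ (norm_nonneg _) hD.le).1 h, inv_mul_cancel₀ hD.ne']

theorem sphereBoost_neg_sphereBoost (hq : 0 < q) (hμ : q ^ 2 = 1 + μ ^ 2) (he : ‖e‖ = 1)
    (hX : ‖X‖ = 1) : sphereBoost (-μ) q e (sphereBoost μ q e X) = X := by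
  have hD := boost_denominator_pos hq hμ he hX
  have h1 : inner ℝ e (sphereBoost μ q e X) =
      (q + μ * inner ℝ e X)⁻¹ * (μ + q * inner ℝ e X) := by
    rw [sphereBoost, real_inner_smul_right, inner_boostNumerator he]
  -- The denominators of the boost and of its inverse are reciprocal, because `q² - μ² = 1`.
  have h2 : q + -μ * ((q + μ * inner ℝ e X)⁻¹ * (μ + q * inner ℝ e X)) =
      (q + μ * inner ℝ e X)⁻¹ := by
    field_simp
    linear_combination hμ
  rw [sphereBoost, boostNumerator, h1, h2, inv_inv, sphereBoost, boostNumerator, smul_add, smul_smul,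
    mul_inv_cancel₀ hD.ne', one_smul, smul_smul, add_assoc, ← add_smul]
  convert add_zero X
  convert zero_smul ℝ e
  field_simp
  linear_combination inner ℝ e X * hμ

theorem contMDiff_sphereBoost_coe {k : ℕ} {e : EuclideanSpace ℝ (Fin (k + 1))}
    (hq : 0 < q) (hμ : q ^ 2 = 1 + μ ^ 2) (he : ‖e‖ = 1) :
    ContMDiff (𝓡 k) 𝓘(ℝ, EuclideanSpace ℝ (Fin (k + 1))) ∞
      (fun p : UnitSphere k => sphereBoost μ q e (p : EuclideanSpace ℝ (Fin (k + 1)))) := by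
  intro p
  have hp : ‖(p : EuclideanSpace ℝ (Fin (k + 1)))‖ = 1 := norm_eq_of_mem_sphere p
  have h : ContDiffAt ℝ ∞ (sphereBoost μ q e) (p : EuclideanSpace ℝ (Fin (k + 1))) := by
    have hi : ContDiff ℝ ∞ (fun X : EuclideanSpace ℝ (Fin (k + 1)) => inner ℝ e X) :=
      contDiff_const.inner ℝ contDiff_id
    have h1 : ContDiff ℝ ∞ (fun X : EuclideanSpace ℝ (Fin (k + 1)) => q + μ * inner ℝ e X) :=
      contDiff_const.add (contDiff_const.mul hi)
    have h2 : ContDiff ℝ ∞ (boostNumerator μ q e) :=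
      contDiff_id.add ((contDiff_const.add (contDiff_const.mul hi)).smul contDiff_const)
    exact (h1.contDiffAt.inv (boost_denominator_pos hq hμ he hp).ne').smul h2.contDiffAt
  exact h.comp_contMDiffAt (contMDiff_coe_unitSphere p)

/-- The Möbius transformation `sphereBoost` as a diffeomorphism of the sphere. -/
noncomputable def sphereBoostDiffeomorph {k : ℕ} {e : EuclideanSpace ℝ (Fin (k + 1))}
    (hq : 0 < q) (hμ : q ^ 2 = 1 + μ ^ 2) (he : ‖e‖ = 1) :
    Diffeomorph (𝓡 k) (𝓡 k) (UnitSphere k) (UnitSphere k) ∞ where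
  toFun p := ⟨sphereBoost μ q e p, mem_sphere_zero_iff_norm.2
    (norm_sphereBoost hq hμ he (norm_eq_of_mem_sphere p))⟩
  invFun p := ⟨sphereBoost (-μ) q e p, mem_sphere_zero_iff_norm.2
    (norm_sphereBoost hq (by rwa [neg_sq]) he (norm_eq_of_mem_sphere p))⟩
  left_inv p := Subtype.ext (sphereBoost_neg_sphereBoost hq hμ he (norm_eq_of_mem_sphere p))
  right_inv p := Subtype.ext (by
    have := sphereBoost_neg_sphereBoost (μ := -μ) hq (by rwa [neg_sq]) he
      (norm_eq_of_mem_sphere p)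
    rwa [neg_neg] at this)
  contMDiff_toFun := contMDiff_unitSphere_of_coe (contMDiff_sphereBoost_coe hq hμ he)
  contMDiff_invFun :=
    contMDiff_unitSphere_of_coe (contMDiff_sphereBoost_coe hq (by rwa [neg_sq]) he)

/-- The boost is a linear isometry, and rescaling a section of the lightcone by `D⁻¹` multiplies its
metric by `D⁻²`: the radial term is null and orthogonal to the cone's tangent vectors. -/
theorem inner_derivative_sphereBoost (hμ : q ^ 2 = 1 + μ ^ 2) (he : ‖e‖ = 1)
    (hX : ‖X‖ = 1) {x y : V} (hx : inner ℝ X x = 0) (hy : inner ℝ X y = 0) {D : ℝ}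
    (hD : D = q + μ * inner ℝ e X) (hD0 : D ≠ 0) :
    inner ℝ
      (D⁻¹ • (x + ((q - 1) * inner ℝ e x) • e) -
        (D⁻¹ ^ 2 * (μ * inner ℝ e x)) • boostNumerator μ q e X)
      (D⁻¹ • (y + ((q - 1) * inner ℝ e y) • e) -
        (D⁻¹ ^ 2 * (μ * inner ℝ e y)) • boostNumerator μ q e X) = D⁻¹ ^ 2 * inner ℝ x y := by
  have hee : inner ℝ e e = 1 := by rw [real_inner_self_eq_norm_sq, he, one_pow]
  have hXX : inner ℝ X X = 1 := by rw [real_inner_self_eq_norm_sq, hX, one_pow]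
  have hx' : inner ℝ x X = 0 := by rw [real_inner_comm, hx]
  simp only [boostNumerator, inner_add_left, inner_add_right, inner_sub_left, inner_sub_right,
    real_inner_smul_left, real_inner_smul_right, hee, hXX, hx', hy,
    real_inner_comm e X, real_inner_comm e x]
  field_simp
  subst hD
  linear_combination (inner ℝ e x * inner ℝ e y * (q ^ 2 - μ ^ 2)) * hμ

theorem isConformalTransformation_sphereBoost {k : ℕ} {e : EuclideanSpace ℝ (Fin (k + 1))}
    (hq : 0 < q) (hμ : q ^ 2 = 1 + μ ^ 2) (he : ‖e‖ = 1) :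
    IsConformalTransformation (sphereBoostDiffeomorph hq hμ he) := by
  intro p
  have hp : ‖(p : EuclideanSpace ℝ (Fin (k + 1)))‖ = 1 := norm_eq_of_mem_sphere p
  have hD := boost_denominator_pos hq hμ he hp
  have hι : MDifferentiable (𝓡 k) 𝓘(ℝ, EuclideanSpace ℝ (Fin (k + 1)))
      (fun q : UnitSphere k => (q : EuclideanSpace ℝ (Fin (k + 1)))) :=
    contMDiff_coe_unitSphere.mdifferentiable (by simp)
  have hd : ∀ X : TangentSpace (𝓡 k) p, differential (𝓡 k)
      (fun r => (sphereBoostDiffeomorph hq hμ he r : EuclideanSpace ℝ (Fin (k + 1)))) p X =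
      let x := differential (𝓡 k)
        (fun q : UnitSphere k => (q : EuclideanSpace ℝ (Fin (k + 1)))) p X
      (q + μ * inner ℝ e (p : EuclideanSpace ℝ (Fin (k + 1))))⁻¹ •
          (x + ((q - 1) * inner ℝ e x) • e) -
        ((q + μ * inner ℝ e (p : EuclideanSpace ℝ (Fin (k + 1))))⁻¹ ^ 2 * (μ * inner ℝ e x)) •
          boostNumerator μ q e p := by
    intro X
    have hDen : HasFDerivAt (fun z => q + μ * inner ℝ e z) (μ • innerSL ℝ e)
        (p : EuclideanSpace ℝ (Fin (k + 1))) :=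
      ((innerSL ℝ e).hasFDerivAt.const_mul μ).const_add q
    have hNum : HasFDerivAt (boostNumerator μ q e) (ContinuousLinearMap.id ℝ _ +
        ((q - 1) • innerSL ℝ e).smulRight e) (p : EuclideanSpace ℝ (Fin (k + 1))) :=
      (hasFDerivAt_id _).add
        ((((innerSL ℝ e).hasFDerivAt.const_mul (q - 1)).const_add μ).smul_const e)
    have h := differential_inv_smul
      (MDifferentiableAt.comp p hDen.differentiableAt.mdifferentiableAt (hι p))
      (MDifferentiableAt.comp p hNum.differentiableAt.mdifferentiableAt (hι p)) hD.ne' X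
    simp only [Function.comp_def] at h
    rw [differential_comp hDen (hι p), differential_comp hNum (hι p)] at h
    exact h
  refine ⟨(q + μ * inner ℝ e (p : EuclideanSpace ℝ (Fin (k + 1))))⁻¹ ^ 2, by positivity,
    fun X Y => ?_⟩
  rw [hd, hd]
  exact inner_derivative_sphereBoost hμ he hp
    (inner_differential_self_eq_zero (hι p) norm_eq_of_mem_sphere X)
    (inner_differential_self_eq_zero (hι p) norm_eq_of_mem_sphere Y) rfl hD.ne'

end Boost

/-! ### The boosted hypersurface in hyperbolic space and its normal. -/

section Hypersurface

variable {n : ℕ}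

/-- The last coordinate of a vector of `ℝ^{n+2}`. -/
noncomputable def lastCoordinate (n : ℕ) : EuclideanSpace ℝ (Fin (n + 1 + 1)) →L[ℝ] ℝ :=
  EuclideanSpace.proj (Fin.last (n + 1))

/-- The linear part of the numerator of the conformal map `S^{n+1} → H^{n+1}` obtained by
composing a boost in the direction of the last coordinate with the hemisphere identification. -/
noncomputable def boostLift (n : ℕ) (μ : ℝ) :
    EuclideanSpace ℝ (Fin (n + 1 + 1)) →L[ℝ] LorentzSpace n :=
  LinearMap.toContinuousLinearMap
    { toFun := fun X => Fin.cons (μ * X (Fin.last (n + 1))) fun j : Fin (n + 1) => X j.castSucc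
      map_add' := fun X Y => by
        funext i
        refine Fin.cases ?_ (fun j => ?_) i <;> simp [mul_add]
      map_smul' := fun c X => by
        funext i
        refine Fin.cases ?_ (fun j => ?_) i <;> simp [mul_left_comm] }

/-- The time axis vector of `L^{n+2}`. -/
def timeAxis (n : ℕ) : LorentzSpace n := Pi.single 0 1

theorem boostLift_zero (μ : ℝ) (X : EuclideanSpace ℝ (Fin (n + 1 + 1))) :
    boostLift n μ X 0 = μ * X (Fin.last (n + 1)) := rfl

theorem boostLift_succ (μ : ℝ) (X : EuclideanSpace ℝ (Fin (n + 1 + 1))) (j : Fin (n + 1)) :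
    boostLift n μ X j.succ = X j.castSucc := rfl

/-- The time component contributes `-μ²` and the omitted last coordinate `-1`, in total `-q²`. -/
theorem lorentzForm_boostLift {μ q : ℝ} (hμ : q ^ 2 = 1 + μ ^ 2)
    (X Y : EuclideanSpace ℝ (Fin (n + 1 + 1))) :
    lorentzForm (boostLift n μ X) (boostLift n μ Y) =
      inner ℝ X Y - q ^ 2 * (X (Fin.last (n + 1)) * Y (Fin.last (n + 1))) := by
  simp only [lorentzForm, boostLift_zero, boostLift_succ, PiLp.inner_apply]
  rw [Fin.sum_univ_castSucc (n := n + 1), hμ]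
  simp only [RCLike.inner_apply, conj_trivial]
  simp only [mul_comm (Y _)]
  ring

theorem lorentzForm_timeAxis_right (z : LorentzSpace n) : lorentzForm z (timeAxis n) = -z 0 := by
  simp [lorentzForm, timeAxis]

theorem lorentzForm_timeAxis_left (z : LorentzSpace n) : lorentzForm (timeAxis n) z = -z 0 := by
  rw [lorentzForm_comm, lorentzForm_timeAxis_right]

theorem lorentzForm_boostLift_affine {μ q : ℝ} (hμ : q ^ 2 = 1 + μ ^ 2)
    (X Y : EuclideanSpace ℝ (Fin (n + 1 + 1))) :
    lorentzForm (boostLift n μ X) (boostLift n μ Y + q • timeAxis n) =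
      inner ℝ X Y - q * X (Fin.last (n + 1)) * (μ + q * Y (Fin.last (n + 1))) := by
  rw [lorentzForm_add_right, lorentzForm_smul_right, lorentzForm_timeAxis_right,
    lorentzForm_boostLift hμ, boostLift_zero]
  ring

theorem lorentzForm_affine_boostLift {μ q : ℝ} (hμ : q ^ 2 = 1 + μ ^ 2)
    (X Y : EuclideanSpace ℝ (Fin (n + 1 + 1))) :
    lorentzForm (boostLift n μ Y + q • timeAxis n) (boostLift n μ X) =
      inner ℝ Y X - q * X (Fin.last (n + 1)) * (μ + q * Y (Fin.last (n + 1))) := by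
  rw [lorentzForm_comm, lorentzForm_boostLift_affine hμ, real_inner_comm]

/-- The boosted null vectors of `(1, X)` and `(1, Y)` still pair to `⟨X, Y⟩ - 1`; dropping their
last coordinates subtracts the product. For `X = Y` of norm `1` only minus the squared denominator
remains. -/
theorem lorentzForm_affine_affine {μ q : ℝ} (hμ : q ^ 2 = 1 + μ ^ 2)
    (X Y : EuclideanSpace ℝ (Fin (n + 1 + 1))) :
    lorentzForm (boostLift n μ X + q • timeAxis n) (boostLift n μ Y + q • timeAxis n) =
      inner ℝ X Y - 1 -
        (μ + q * X (Fin.last (n + 1))) * (μ + q * Y (Fin.last (n + 1))) := by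
  rw [lorentzForm_add_left, lorentzForm_boostLift_affine hμ, lorentzForm_smul_left,
    lorentzForm_timeAxis_left, Pi.add_apply, boostLift_zero, Pi.smul_apply, smul_eq_mul]
  rw [show timeAxis n 0 = 1 from rfl]
  linear_combination -hμ

variable {M : Type*} {X N : M → EuclideanSpace ℝ (Fin (n + 1 + 1))} {μ q : ℝ}

/-- The hypersurface of `H^{n+1}` which corresponds to the hypersurface `X` of `S^{n+1}` after a
boost of the sphere in the direction of the last coordinate. -/
noncomputable def boostedHypersurface (μ q : ℝ) (X : M → EuclideanSpace ℝ (Fin (n + 1 + 1)))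
    (p : M) : LorentzSpace n :=
  (μ + q * X p (Fin.last (n + 1)))⁻¹ • (boostLift n μ (X p) + q • timeAxis n)

/-- The unit normal of `boostedHypersurface μ q X` which corresponds to the unit normal `N` of
`X` in the sphere. -/
noncomputable def boostedNormal (μ q : ℝ) (X N : M → EuclideanSpace ℝ (Fin (n + 1 + 1)))
    (p : M) : LorentzSpace n :=
  boostLift n μ (N p) - (q * N p (Fin.last (n + 1))) • boostedHypersurface μ q X p

theorem boost_denominator_last_pos (hq : 0 < q) (hμ : q ^ 2 = 1 + μ ^ 2)
    {Y : EuclideanSpace ℝ (Fin (n + 1 + 1))} (hY : ‖Y‖ = 1) :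
    0 < q + μ * Y (Fin.last (n + 1)) := by
  have hD := boost_denominator_pos (e := EuclideanSpace.single (Fin.last (n + 1)) 1) hq hμ
    (by simp) hY
  simpa only [EuclideanSpace.inner_single_left, map_one, one_mul] using hD

theorem boostedHypersurface_mem (hq : 0 < q) (hμ : q ^ 2 = 1 + μ ^ 2) (h1 : ∀ p, ‖X p‖ = 1)
    (hS : ∀ p, 0 < μ + q * X p (Fin.last (n + 1))) (p : M) :
    boostedHypersurface μ q X p ∈ hyperbolicSpace n := by
  have hXX : inner ℝ (X p) (X p) = 1 := by rw [real_inner_self_eq_norm_sq, h1, one_pow]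
  have hSp := hS p
  constructor
  · simp only [boostedHypersurface, lorentzForm_smul_left, lorentzForm_smul_right,
      lorentzForm_affine_affine hμ, hXX]
    field_simp
    ring
  · have hD := boost_denominator_last_pos hq hμ (h1 p)
    simp only [boostedHypersurface, Pi.smul_apply, Pi.add_apply, boostLift_zero, smul_eq_mul]
    rw [show timeAxis n 0 = 1 from rfl]
    exact mul_pos (inv_pos.2 hSp) (by linarith)

variable {E : Type*} [NormedAddCommGroup E] [NormedSpace ℝ E] {H : Type*} [TopologicalSpace H]
  {I : ModelWithCorners ℝ E H} [TopologicalSpace M] [ChartedSpace H M]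

theorem contMDiff_last (hX : ContMDiff I 𝓘(ℝ, EuclideanSpace ℝ (Fin (n + 1 + 1))) ∞ X) :
    ContMDiff I 𝓘(ℝ, ℝ) ∞ fun p => X p (Fin.last (n + 1)) :=
  (lastCoordinate n).contDiff.comp_contMDiff hX

theorem contMDiff_boostedHypersurface
    (hX : ContMDiff I 𝓘(ℝ, EuclideanSpace ℝ (Fin (n + 1 + 1))) ∞ X)
    (hS : ∀ p, μ + q * X p (Fin.last (n + 1)) ≠ 0) :
    ContMDiff I 𝓘(ℝ, LorentzSpace n) ∞ (boostedHypersurface μ q X) := by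
  have h1 : ContMDiff I 𝓘(ℝ, ℝ) ∞ fun p => μ + q * X p (Fin.last (n + 1)) :=
    ContDiff.comp_contMDiff (g := fun t : ℝ => μ + q * t) (by fun_prop) (contMDiff_last hX)
  exact (h1.inv₀ hS).smul
    (((boostLift n μ).contDiff.add contDiff_const).comp_contMDiff hX)

theorem contMDiff_boostedNormal
    (hX : ContMDiff I 𝓘(ℝ, EuclideanSpace ℝ (Fin (n + 1 + 1))) ∞ X)
    (hN : ContMDiff I 𝓘(ℝ, EuclideanSpace ℝ (Fin (n + 1 + 1))) ∞ N)
    (hS : ∀ p, μ + q * X p (Fin.last (n + 1)) ≠ 0) :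
    ContMDiff I 𝓘(ℝ, LorentzSpace n) ∞ (boostedNormal μ q X N) := by
  have h1 : ContMDiff I 𝓘(ℝ, ℝ) ∞ fun p => q * N p (Fin.last (n + 1)) :=
    ContDiff.comp_contMDiff (g := fun t : ℝ => q * t) (by fun_prop) (contMDiff_last hN)
  exact ((boostLift n μ).contDiff.comp_contMDiff hN).sub
    (h1.smul (contMDiff_boostedHypersurface hX hS))

theorem differential_boostedHypersurface
    (hX : ContMDiff I 𝓘(ℝ, EuclideanSpace ℝ (Fin (n + 1 + 1))) ∞ X)
    (hS : ∀ p, μ + q * X p (Fin.last (n + 1)) ≠ 0) (p : M) (Z : TangentSpace I p) :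
    differential I (boostedHypersurface μ q X) p Z =
      (μ + q * X p (Fin.last (n + 1)))⁻¹ • boostLift n μ (differential I X p Z) -
      ((μ + q * X p (Fin.last (n + 1)))⁻¹ ^ 2 *
        (q * differential I X p Z (Fin.last (n + 1)))) •
          (boostLift n μ (X p) + q • timeAxis n) := by
  have hd : MDifferentiableAt I 𝓘(ℝ, EuclideanSpace ℝ (Fin (n + 1 + 1))) X p :=
    hX.mdifferentiable (by simp) p
  have hDen : HasFDerivAt
      (fun z : EuclideanSpace ℝ (Fin (n + 1 + 1)) => μ + q * z (Fin.last (n + 1)))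
      (q • lastCoordinate n) (X p) :=
    ((lastCoordinate n).hasFDerivAt.const_mul q).const_add μ
  have hNum : HasFDerivAt (fun z => boostLift n μ z + q • timeAxis n) (boostLift n μ) (X p) :=
    (boostLift n μ).hasFDerivAt.add_const _
  have h := differential_inv_smul
    (MDifferentiableAt.comp p hDen.differentiableAt.mdifferentiableAt hd)
    (MDifferentiableAt.comp p hNum.differentiableAt.mdifferentiableAt hd) (hS p) Z
  simp only [Function.comp_def] at h
  rw [differential_comp hDen hd, differential_comp hNum hd] at h
  exact h

/-- Conformality: `⟨df, df⟩ = ⟨dX, dX⟩ / S²` with `S` the denominator, so the kernel of `df` lies in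
that of `dX`. -/
theorem isSmoothImmersion_boostedHypersurface (hμ : q ^ 2 = 1 + μ ^ 2)
    (hX : IsSmoothImmersion I X) (h1 : ∀ p, ‖X p‖ = 1)
    (hS : ∀ p, μ + q * X p (Fin.last (n + 1)) ≠ 0) :
    IsSmoothImmersion I (boostedHypersurface μ q X) := by
  refine ⟨contMDiff_boostedHypersurface hX.1 hS, fun p => ?_⟩
  refine (injective_iff_map_eq_zero
    (mfderiv I 𝓘(ℝ, LorentzSpace n) (boostedHypersurface μ q X) p)).2 fun Z hZ => ?_
  have hXX : inner ℝ (X p) (X p) = 1 := by rw [real_inner_self_eq_norm_sq, h1, one_pow]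
  have hXx := inner_differential_self_eq_zero (hX.1.mdifferentiable (by simp) p) h1 Z
  have hxX : inner ℝ (differential I X p Z) (X p) = 0 := by rw [real_inner_comm, hXx]
  have hSp := hS p
  have h0 : differential I (boostedHypersurface μ q X) p Z = 0 := hZ
  have hf := congrArg (fun w => lorentzForm w w) h0
  rw [differential_boostedHypersurface hX.1 hS] at hf
  simp only [lorentzForm_smul_left, lorentzForm_smul_right, lorentzForm_sub_left,
    lorentzForm_sub_right, lorentzForm_boostLift hμ, lorentzForm_boostLift_affine hμ,
    lorentzForm_affine_boostLift hμ, lorentzForm_affine_affine hμ, hXX, hXx, hxX] at hf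
  rw [show lorentzForm (0 : LorentzSpace n) 0 = 0 by simp [← lorentzBilin_apply]] at hf
  field_simp at hf
  have hx : inner ℝ (differential I X p Z) (differential I X p Z) = 0 := by
    refine (mul_eq_zero.1 (?_ : (μ + q * X p (Fin.last (n + 1))) ^ 2 * _ = 0)).resolve_left
      (pow_ne_zero 2 hSp)
    linear_combination hf
  exact hX.2 p ((inner_self_eq_zero.1 hx).trans (differential_zero X p).symm)

/-- The field is `S` times the image of `N` under the differential of the conformal map with factor
`S⁻²`, hence unit and normal. -/
theorem isUnitNormalField_boostedNormal (hμ : q ^ 2 = 1 + μ ^ 2)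
    (hX : ContMDiff I 𝓘(ℝ, EuclideanSpace ℝ (Fin (n + 1 + 1))) ∞ X)
    (hN : ContMDiff I 𝓘(ℝ, EuclideanSpace ℝ (Fin (n + 1 + 1))) ∞ N)
    (h1 : ∀ p, ‖X p‖ = 1) (h2 : ∀ p, ‖N p‖ = 1) (h3 : ∀ p, inner ℝ (X p) (N p) = 0)
    (h4 : ∀ p Z, inner ℝ (differential I X p Z) (N p) = 0)
    (hS : ∀ p, μ + q * X p (Fin.last (n + 1)) ≠ 0) :
    IsUnitNormalField I (boostedHypersurface μ q X) (boostedNormal μ q X N) := by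
  have hXX : ∀ p, inner ℝ (X p) (X p) = 1 := fun p => by
    rw [real_inner_self_eq_norm_sq, h1, one_pow]
  have hNN : ∀ p, inner ℝ (N p) (N p) = 1 := fun p => by
    rw [real_inner_self_eq_norm_sq, h2, one_pow]
  have hNX : ∀ p, inner ℝ (N p) (X p) = 0 := fun p => by rw [real_inner_comm, h3]
  refine ⟨contMDiff_boostedNormal hX hN hS, fun p => ?_, fun p => ?_, fun p Z => ?_⟩
  · have hSp := hS p
    simp only [boostedNormal, boostedHypersurface, lorentzForm_smul_left, lorentzForm_smul_right,
      lorentzForm_sub_left, lorentzForm_boostLift_affine hμ, lorentzForm_affine_affine hμ, hXX, hNX]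
    field_simp
    ring
  · have hSp := hS p
    simp only [boostedNormal, boostedHypersurface, lorentzForm_smul_left, lorentzForm_smul_right,
      lorentzForm_sub_left, lorentzForm_sub_right, lorentzForm_boostLift hμ,
      lorentzForm_boostLift_affine hμ, lorentzForm_affine_boostLift hμ,
      lorentzForm_affine_affine hμ, hXX, hNX, hNN, h3]
    field_simp
    ring
  · have hSp := hS p
    have hXx := inner_differential_self_eq_zero (hX.mdifferentiable (by simp) p) h1 Z
    have hxX : inner ℝ (differential I X p Z) (X p) = 0 := by rw [real_inner_comm, hXx]
    rw [differential_boostedHypersurface hX hS]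
    simp only [boostedNormal, boostedHypersurface, lorentzForm_smul_left, lorentzForm_smul_right,
      lorentzForm_sub_left, lorentzForm_sub_right, lorentzForm_boostLift hμ,
      lorentzForm_boostLift_affine hμ, lorentzForm_affine_boostLift hμ,
      lorentzForm_affine_affine hμ, h4 p Z, hXX, h3, hxX]
    field_simp
    ring

end Hypersurface

/-! ### Differentials on product manifolds. -/

section Product

variable {E : Type*} [NormedAddCommGroup E] [NormedSpace ℝ E] {H : Type*} [TopologicalSpace H]
  {I : ModelWithCorners ℝ E H} {M : Type*} [TopologicalSpace M] [ChartedSpace H M]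
  {E' : Type*} [NormedAddCommGroup E'] [NormedSpace ℝ E'] {H' : Type*} [TopologicalSpace H']
  {I' : ModelWithCorners ℝ E' H'} {M' : Type*} [TopologicalSpace M'] [ChartedSpace H' M']
  {V : Type*} [NormedAddCommGroup V] [NormedSpace ℝ V]
  {W : Type*} [NormedAddCommGroup W] [NormedSpace ℝ W]

theorem differential_prodMap {F : M → V} {G : M' → W} {p : M × M'}
    (hF : MDifferentiableAt I 𝓘(ℝ, V) F p.1) (hG : MDifferentiableAt I' 𝓘(ℝ, W) G p.2)
    (Z : TangentSpace (I.prod I') p) :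
    differential (I.prod I') (fun q : M × M' => (F q.1, G q.2)) p Z =
      (differential I F p.1 Z.1, differential I' G p.2 Z.2) := by
  have h1 := HasMFDerivAt.comp p hF.hasMFDerivAt (hasMFDerivAt_fst (I := I) (I' := I') p)
  have h2 := HasMFDerivAt.comp p hG.hasMFDerivAt (hasMFDerivAt_snd (I := I) (I' := I') p)
  have h := differential_prodMk h1.mdifferentiableAt h2.mdifferentiableAt Z
  simp only [Function.comp_def] at h
  rw [h]
  exact Prod.ext (congrArg (fun L : (E × E') →L[ℝ] V => L Z) h1.mfderiv)
    (congrArg (fun L : (E × E') →L[ℝ] W => L Z) h2.mfderiv)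

theorem differential_eq_zero_of_slice_const {F : M × M' → V} {u : M} {v : M'}
    (hF : MDifferentiableAt (I.prod I') 𝓘(ℝ, V) F (u, v)) {w : V} (hw : ∀ u', F (u', v) = w)
    (z : E) : differential (I.prod I') F (u, v) ((z, 0) : E × E') = 0 := by
  have h := HasMFDerivAt.comp (f := fun u' : M => (u', v)) u hF.hasMFDerivAt
    ((hasMFDerivAt_id (I := I) u).prodMk (hasMFDerivAt_const (I' := I') v u))
  have hc : (F ∘ fun u' : M => (u', v)) = fun _ => w := funext hw
  rw [hc] at h
  have := h.mfderiv
  rw [mfderiv_const] at this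
  exact (congrArg (fun L : E →L[ℝ] V => L z) this).symm

end Product

/-! ### The generalized Clifford torus in the sphere. -/

section Clifford

variable {n : ℕ}

/-- `cliffordVector` as a continuous linear map. -/
noncomputable def cliffordCLM (n : ℕ) (a b : ℝ) :
    (EuclideanSpace ℝ (Fin 3) × EuclideanSpace ℝ (Fin (n - 2 + 1))) →L[ℝ]
      EuclideanSpace ℝ (Fin (n + 1 + 1)) :=
  LinearMap.toContinuousLinearMap
    { toFun := fun w => cliffordVector (n := n) a b w.1 w.2
      map_add' := fun w w' => by
        ext i
        by_cases h : (i : ℕ) < 3 <;> simp [cliffordVector, h, mul_add]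
      map_smul' := fun c w => by
        ext i
        by_cases h : (i : ℕ) < 3 <;> simp [cliffordVector, h, mul_left_comm] }

theorem cliffordCLM_apply (a b : ℝ)
    (w : EuclideanSpace ℝ (Fin 3) × EuclideanSpace ℝ (Fin (n - 2 + 1))) :
    cliffordCLM n a b w = cliffordVector (n := n) a b w.1 w.2 := rfl

theorem cliffordVector_eq_add (a b : ℝ) (u : EuclideanSpace ℝ (Fin 3))
    (v : EuclideanSpace ℝ (Fin (n - 2 + 1))) :
    cliffordVector (n := n) a b u v =
      a • cliffordVector (n := n) 1 0 u 0 + b • cliffordVector (n := n) 0 1 0 v := by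
  ext i
  by_cases h : (i : ℕ) < 3 <;> simp [cliffordVector, h]

/-- Independence of `u` makes the boost denominator constant on the slices `S^2 × {v}`. -/
theorem cliffordVector_last (hn : 3 ≤ n) (a b : ℝ) (u : EuclideanSpace ℝ (Fin 3))
    (v : EuclideanSpace ℝ (Fin (n - 2 + 1))) :
    cliffordVector (n := n) a b u v (Fin.last (n + 1)) = b * v (Fin.last (n - 2)) := by
  have h : ¬ ((Fin.last (n + 1) : Fin (n + 1 + 1)) : ℕ) < 3 := by simp; omega
  have h' : (⟨(Fin.last (n + 1) : Fin (n + 1 + 1)) - 3, by simp⟩ : Fin (n - 2 + 1)) =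
      Fin.last (n - 2) := by
    ext
    simp
  simp only [cliffordVector, h, dite_false, h']

theorem inner_cliffordVector (hn : 3 ≤ n) (a b a' b' : ℝ) (u u' : EuclideanSpace ℝ (Fin 3))
    (v v' : EuclideanSpace ℝ (Fin (n - 2 + 1))) :
    inner ℝ (cliffordVector (n := n) a b u v) (cliffordVector (n := n) a' b' u' v') =
      a * a' * inner ℝ u u' + b * b' * inner ℝ v v' := by
  obtain ⟨m, rfl⟩ : ∃ m, n = m + 2 := ⟨n - 2, by omega⟩
  simp only [PiLp.inner_apply, RCLike.inner_apply, conj_trivial]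
  have e : 3 + (m + 1) = m + 2 + 1 + 1 := by omega
  rw [← (finCongr e).sum_comp, Fin.sum_univ_add, Finset.mul_sum, Finset.mul_sum]
  have h1 : ∀ (a b : ℝ) (u) (v) (i : Fin 3),
      cliffordVector (n := m + 2) a b u v (finCongr e (Fin.castAdd (m + 1) i)) = a * u i := by
    intro a b u v i; simp [cliffordVector]
  have h2 : ∀ (a b : ℝ) (u) (v) (i : Fin (m + 1)),
      cliffordVector (n := m + 2) a b u v (finCongr e (Fin.natAdd 3 i)) =
        b * (v : EuclideanSpace ℝ (Fin (m + 2 - 2 + 1))) i := by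
    intro a b u v i; simp [cliffordVector]
  congr 1
  · refine Finset.sum_congr rfl fun i _ => ?_
    rw [h1, h1]; ring
  · refine Finset.sum_congr rfl fun i _ => ?_
    rw [h2, h2]; ring

/-- The composition of the generalized Clifford map with the inclusions of the spheres. -/
noncomputable def cliffordMap (n : ℕ) (a b : ℝ) (p : UnitSphere 2 × UnitSphere (n - 2)) :
    EuclideanSpace ℝ (Fin (n + 1 + 1)) :=
  cliffordVector (n := n) a b p.1 p.2

theorem contMDiff_coe_unitSphere_prod : ContMDiff ((𝓡 2).prod (𝓡 (n - 2)))
    𝓘(ℝ, EuclideanSpace ℝ (Fin (2 + 1)) × EuclideanSpace ℝ (Fin (n - 2 + 1))) ∞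
    (fun p : UnitSphere 2 × UnitSphere (n - 2) =>
      ((p.1 : EuclideanSpace ℝ (Fin (2 + 1))), (p.2 : EuclideanSpace ℝ (Fin (n - 2 + 1))))) :=
  (contMDiff_coe_unitSphere.comp contMDiff_fst).prodMk_space
    (contMDiff_coe_unitSphere.comp contMDiff_snd)

theorem contMDiff_cliffordMap (a b : ℝ) : ContMDiff ((𝓡 2).prod (𝓡 (n - 2)))
    𝓘(ℝ, EuclideanSpace ℝ (Fin (n + 1 + 1))) ∞ (cliffordMap n a b) :=
  (cliffordCLM n a b).contDiff.comp_contMDiff contMDiff_coe_unitSphere_prod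

theorem differential_cliffordMap (a b : ℝ) (p : UnitSphere 2 × UnitSphere (n - 2))
    (Z : TangentSpace ((𝓡 2).prod (𝓡 (n - 2))) p) :
    differential ((𝓡 2).prod (𝓡 (n - 2))) (cliffordMap n a b) p Z =
      cliffordVector (n := n) a b
        (differential (𝓡 2) (fun u : UnitSphere 2 => (u : EuclideanSpace ℝ (Fin (2 + 1)))) p.1 Z.1)
        (differential (𝓡 (n - 2))
          (fun v : UnitSphere (n - 2) => (v : EuclideanSpace ℝ (Fin (n - 2 + 1)))) p.2 Z.2) := by
  have h := differential_clm (cliffordCLM n a b)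
    ((contMDiff_coe_unitSphere_prod (n := n)).mdifferentiable (by simp) p) Z
  rw [differential_prodMap (contMDiff_coe_unitSphere.mdifferentiable (by simp) p.1)
    (contMDiff_coe_unitSphere.mdifferentiable (by simp) p.2)] at h
  exact h

theorem inner_unitSphere_self {k : ℕ} (p : UnitSphere k) :
    inner ℝ (p : EuclideanSpace ℝ (Fin (k + 1))) p = 1 := by
  rw [real_inner_self_eq_norm_sq, norm_eq_of_mem_sphere p, one_pow]

theorem norm_cliffordMap (hn : 3 ≤ n) {a b : ℝ} (hab : a ^ 2 + b ^ 2 = 1)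
    (p : UnitSphere 2 × UnitSphere (n - 2)) : ‖cliffordMap n a b p‖ = 1 :=
  norm_eq_of_mem_sphere (cliffordTorus hn hab p)

/-- The unit normal of the torus in the sphere comes from turning `(a, b)` into `(-b, a)`. -/
theorem inner_cliffordMap_normal (hn : 3 ≤ n) (a b : ℝ)
    (p : UnitSphere 2 × UnitSphere (n - 2)) :
    inner ℝ (cliffordMap n a b p) (cliffordMap n (-b) a p) = 0 := by
  simp only [cliffordMap]
  rw [inner_cliffordVector hn, inner_unitSphere_self, inner_unitSphere_self]
  ring

theorem inner_differential_cliffordMap_normal (hn : 3 ≤ n) (a b : ℝ)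
    (p : UnitSphere 2 × UnitSphere (n - 2)) (Z : TangentSpace ((𝓡 2).prod (𝓡 (n - 2))) p) :
    inner ℝ (differential ((𝓡 2).prod (𝓡 (n - 2))) (cliffordMap n a b) p Z)
      (cliffordMap n (-b) a p) = 0 := by
  have hu := inner_differential_self_eq_zero
    (contMDiff_coe_unitSphere.mdifferentiable (by simp) p.1) norm_eq_of_mem_sphere Z.1
  have hv := inner_differential_self_eq_zero
    (contMDiff_coe_unitSphere.mdifferentiable (by simp) p.2) norm_eq_of_mem_sphere Z.2
  rw [differential_cliffordMap, cliffordMap, inner_cliffordVector hn, real_inner_comm, hu,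
    real_inner_comm, hv]
  ring

theorem isSmoothImmersion_cliffordMap (hn : 3 ≤ n) {a b : ℝ} (ha : a ≠ 0) (hb : b ≠ 0) :
    IsSmoothImmersion ((𝓡 2).prod (𝓡 (n - 2))) (cliffordMap n a b) := by
  refine ⟨contMDiff_cliffordMap a b, fun p Z Z' h => ?_⟩
  have hinj : Function.Injective (cliffordCLM n a b) := by
    refine (injective_iff_map_eq_zero _).2 fun w hw => ?_
    have h0 := inner_cliffordVector hn a b a b w.1 w.1 w.2 w.2
    rw [← cliffordCLM_apply, hw, inner_zero_left] at h0
    have h1 : 0 ≤ inner ℝ w.1 w.1 := real_inner_self_nonneg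
    have h2 : 0 ≤ inner ℝ w.2 w.2 := real_inner_self_nonneg
    have ha' : 0 < a * a := mul_self_pos.2 ha
    have hb' : 0 < b * b := mul_self_pos.2 hb
    have h3 := mul_nonneg ha'.le h1
    have h4 := mul_nonneg hb'.le h2
    have h5 : a * a * inner ℝ w.1 w.1 = 0 := by linarith
    have h6 : b * b * inner ℝ w.2 w.2 = 0 := by linarith
    exact Prod.ext (inner_self_eq_zero.1 ((mul_eq_zero.1 h5).resolve_left ha'.ne'))
      (inner_self_eq_zero.1 ((mul_eq_zero.1 h6).resolve_left hb'.ne'))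
  rw [differential_cliffordMap, differential_cliffordMap] at h
  have h' := Prod.mk.inj (hinj (a₁ := (_, _)) (a₂ := (_, _)) h)
  exact Prod.ext (injective_differential_coe_unitSphere p.1 h'.1)
    (injective_differential_coe_unitSphere p.2 h'.2)

/-- Positivity of `k` provides a second coordinate to absorb the remaining length. -/
theorem exists_unitSphere_last_eq {k : ℕ} (hk : 0 < k) {y : ℝ} (hy : y ^ 2 ≤ 1) :
    ∃ v : UnitSphere k, (v : EuclideanSpace ℝ (Fin (k + 1))) (Fin.last k) = y := by
  have hne : (0 : Fin (k + 1)) ≠ Fin.last k := by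
    intro h
    have := congrArg Fin.val h
    simp at this
    omega
  refine ⟨⟨EuclideanSpace.single 0 (Real.sqrt (1 - y ^ 2)) + EuclideanSpace.single (Fin.last k) y,
    mem_sphere_zero_iff_norm.2 ?_⟩, by simp [hne.symm]⟩
  rw [← sq_eq_sq₀ (norm_nonneg _) zero_le_one, ← real_inner_self_eq_norm_sq, inner_add_left,
    inner_add_right, inner_add_right]
  simp only [EuclideanSpace.inner_single_left, conj_trivial]
  simp [hne, hne.symm]
  rw [Real.mul_self_sqrt (by linarith)]
  ring

theorem preconnectedSpace_unitSphere {k : ℕ} (hk : 0 < k) : PreconnectedSpace (UnitSphere k) := by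
  refine Subtype.preconnectedSpace (isPreconnected_sphere (Module.lt_rank_of_lt_finrank ?_) _ _)
  rw [finrank_euclideanSpace_fin]
  exact_mod_cast Nat.succ_lt_succ hk

end Clifford

/-! ### The degenerate slice and the choice of the boost. -/

section Main

variable {n : ℕ}

/-- On a slice `S^2 × {v}` along which the first principal curvature of the boosted Clifford torus
is `∓ 1`, the map `f ∓ ν` is constant. -/
theorem boostedHypersurface_sub_boostedNormal_slice (hn : 3 ≤ n) {a b μ q ε : ℝ}
    (hab : a ^ 2 + b ^ 2 = 1) (hε : ε ^ 2 = 1) {v : UnitSphere (n - 2)}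
    (hv : q * (v : EuclideanSpace ℝ (Fin (n - 2 + 1))) (Fin.last (n - 2)) = -(ε * a + b * μ))
    (hS : μ + q * (b * (v : EuclideanSpace ℝ (Fin (n - 2 + 1))) (Fin.last (n - 2))) ≠ 0)
    (u u' : UnitSphere 2) :
    boostedHypersurface μ q (cliffordMap n a b) (u, v) -
        ε • boostedNormal μ q (cliffordMap n a b) (cliffordMap n (-b) a) (u, v) =
      boostedHypersurface μ q (cliffordMap n a b) (u', v) -
        ε • boostedNormal μ q (cliffordMap n a b) (cliffordMap n (-b) a) (u', v) := by
  set y := (v : EuclideanSpace ℝ (Fin (n - 2 + 1))) (Fin.last (n - 2)) with hy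
  have key : ∀ w : UnitSphere 2, boostedHypersurface μ q (cliffordMap n a b) (w, v) -
        ε • boostedNormal μ q (cliffordMap n a b) (cliffordMap n (-b) a) (w, v) =
      ((1 + ε * (q * (a * y))) * (μ + q * (b * y))⁻¹ * b - ε * a) •
          boostLift n μ (cliffordVector (n := n) 0 1 0 v) +
        ((1 + ε * (q * (a * y))) * (μ + q * (b * y))⁻¹) • q • timeAxis n := by
    intro w
    -- This is the total coefficient of the `u`-part. It vanishes exactly by the choice of `y` in
    -- `hv`, that is, when `(bμ + qy)/a = -ε`.
    have h0 : (1 + ε * (q * (a * y))) * (μ + q * (b * y))⁻¹ * a + ε * b = 0 := by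
      have h : (1 + ε * (q * (a * y))) * a + ε * b * (μ + q * (b * y)) = 0 := by
        linear_combination ε * q * y * hab + ε * hv - a * hε
      rw [mul_right_comm, ← mul_inv_cancel_right₀ hS (ε * b), ← add_mul, h, zero_mul]
    simp only [boostedNormal, boostedHypersurface, cliffordMap, cliffordVector_last hn, ← hy]
    rw [cliffordVector_eq_add a b, cliffordVector_eq_add (-b) a]
    simp only [map_add, map_smul]
    rw [← sub_eq_zero]
    trans ((1 + ε * (q * (a * y))) * (μ + q * (b * y))⁻¹ * a + ε * b) •
      boostLift n μ (cliffordVector (n := n) 1 0 w 0)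
    · module
    · rw [h0, zero_smul]
  rw [key, key]

theorem not_isSmoothImmersion_of_sub_slice_const {E : Type*} [NormedAddCommGroup E]
    [NormedSpace ℝ E] {H : Type*} [TopologicalSpace H]
    {I : ModelWithCorners ℝ E H} {M : Type*} [TopologicalSpace M] [ChartedSpace H M]
    {E' : Type*} [NormedAddCommGroup E'] [NormedSpace ℝ E'] {H' : Type*} [TopologicalSpace H']
    {I' : ModelWithCorners ℝ E' H'} {M' : Type*} [TopologicalSpace M'] [ChartedSpace H' M']
    {V : Type*} [NormedAddCommGroup V] [NormedSpace ℝ V] [Nontrivial E] [Nonempty M]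
    {F : M × M' → V} {v : M'} (hw : ∀ u u', F (u, v) = F (u', v)) :
    ¬ IsSmoothImmersion (I.prod I') F := by
  intro h
  obtain ⟨u⟩ := ‹Nonempty M›
  obtain ⟨z, hz⟩ := exists_ne (0 : E)
  have h1 := differential_eq_zero_of_slice_const (h.1.mdifferentiable (by simp) (u, v))
    (fun u' => hw u' u) z
  have h2 := h.2 (u, v) (h1.trans (differential_zero F (u, v)).symm)
  exact hz (congrArg Prod.fst h2)

theorem sphereBoost_last (μ q : ℝ) (X : EuclideanSpace ℝ (Fin (n + 1 + 1))) :
    sphereBoost μ q (EuclideanSpace.single (Fin.last (n + 1)) 1) X (Fin.last (n + 1)) =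
      (q + μ * X (Fin.last (n + 1)))⁻¹ * (μ + q * X (Fin.last (n + 1))) := by
  simp only [sphereBoost, boostNumerator, EuclideanSpace.inner_single_left, map_one, one_mul,
    PiLp.smul_apply, PiLp.add_apply, smul_eq_mul, PiLp.single_apply, if_true]
  ring

theorem sphereBoost_castSucc (μ q : ℝ) (X : EuclideanSpace ℝ (Fin (n + 1 + 1)))
    (j : Fin (n + 1)) :
    sphereBoost μ q (EuclideanSpace.single (Fin.last (n + 1)) 1) X j.castSucc =
      (q + μ * X (Fin.last (n + 1)))⁻¹ * X j.castSucc := by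
  simp only [sphereBoost, boostNumerator, EuclideanSpace.inner_single_left, map_one, one_mul,
    PiLp.smul_apply, PiLp.add_apply, smul_eq_mul, PiLp.single_apply,
    j.castSucc_ne_last, if_false, mul_zero, add_zero]

/-- The denominator `q + μ X_last` of the boost cancels in the quotients defining the hemisphere
identification. -/
theorem boostedHypersurface_eq_hemisphereToHyperbolic {μ q : ℝ} (hq : 0 < q)
    (hμ : q ^ 2 = 1 + μ ^ 2) {M : Type*} {X : M → EuclideanSpace ℝ (Fin (n + 1 + 1))} {p : M}
    (hX : ‖X p‖ = 1) (hS : μ + q * X p (Fin.last (n + 1)) ≠ 0) {Y : UnitSphere (n + 1)}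
    (hY : (Y : EuclideanSpace ℝ (Fin (n + 1 + 1))) =
      sphereBoost μ q (EuclideanSpace.single (Fin.last (n + 1)) 1) (X p)) :
    boostedHypersurface μ q X p = hemisphereToHyperbolic Y := by
  have hD := (boost_denominator_last_pos hq hμ hX).ne'
  funext i
  refine Fin.cases ?_ (fun j => ?_) i
  · simp only [hemisphereToHyperbolic, Fin.cons_zero, boostedHypersurface, Pi.smul_apply,
      Pi.add_apply, boostLift_zero, smul_eq_mul]
    rw [hY, sphereBoost_last, show timeAxis n 0 = 1 from rfl]
    field_simp
    ring
  · simp only [hemisphereToHyperbolic, Fin.cons_succ, boostedHypersurface, Pi.smul_apply,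
      Pi.add_apply, boostLift_succ, smul_eq_mul]
    rw [hY, sphereBoost_last, sphereBoost_castSucc, show timeAxis n j.succ = 0 from rfl]
    field_simp
    ring

theorem boosted_clifford_last_pos (hn : 3 ≤ n) {a b μ q : ℝ} (hab : a ^ 2 + b ^ 2 = 1)
    (hb : 0 < b) (hq : 0 < q) (hμ0 : 0 ≤ μ) (hμ : q ^ 2 = 1 + μ ^ 2) (hqa : q * a = 2)
    (p : UnitSphere 2 × UnitSphere (n - 2)) :
    0 < μ + q * cliffordMap n a b p (Fin.last (n + 1)) := by
  rw [cliffordMap, cliffordVector_last hn]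
  have h1 : |(p.2 : EuclideanSpace ℝ (Fin (n - 2 + 1))) (Fin.last (n - 2))| ≤ 1 := by
    have := PiLp.norm_apply_le (p.2 : EuclideanSpace ℝ (Fin (n - 2 + 1))) (Fin.last (n - 2))
    rwa [norm_eq_of_mem_sphere, Real.norm_eq_abs] at this
  -- The torus has last coordinate at least `-b`, so this suffices. It holds as `(qb)² = q² - (qa)²
  -- = q² - 4 < q² - 1 = μ²`.
  have h2 : q * b < μ := by
    refine lt_of_pow_lt_pow_left₀ 2 hμ0 ?_
    have h3 : (q * a) ^ 2 = 4 := by rw [hqa]; norm_num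
    have h4 : (q * b) ^ 2 = q ^ 2 - 4 := by linear_combination q ^ 2 * hab - h3
    linarith
  have h3 : -(q * b) ≤ q * b * (p.2 : EuclideanSpace ℝ (Fin (n - 2 + 1))) (Fin.last (n - 2)) := by
    nlinarith [(abs_le.1 h1).1, mul_pos hq hb]
  linarith

theorem exists_slice (hn : 3 ≤ n) {a b μ q ε : ℝ} (hab : a ^ 2 + b ^ 2 = 1) (hq : 0 < q)
    (hμ : q ^ 2 = 1 + μ ^ 2) (hε : ε ^ 2 = 1) : ∃ v : UnitSphere (n - 2),
    q * (v : EuclideanSpace ℝ (Fin (n - 2 + 1))) (Fin.last (n - 2)) = -(ε * a + b * μ) := by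
  have hy : (-(ε * a + b * μ) / q) ^ 2 ≤ 1 := by
    rw [div_pow, div_le_one (by positivity)]
    -- Lagrange's identity for `(a, b)` of norm `1` and `(ε, μ)` of norm `q`, giving Cauchy–Schwarz.
    have h : (ε * a + b * μ) ^ 2 + (a * μ - ε * b) ^ 2 = q ^ 2 := by
      linear_combination (a ^ 2 + b ^ 2) * hε + (1 + μ ^ 2) * hab - hμ
    nlinarith [sq_nonneg (a * μ - ε * b)]
  obtain ⟨v, hv⟩ := exists_unitSphere_last_eq (k := n - 2) (by omega) hy
  exact ⟨v, by rw [hv]; field_simp⟩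

end Main

theorem mainTheorem10 (n : ℕ) (hn : 3 ≤ n) (a b : ℝ) (ha : 0 < a) (hb : 0 < b)
    (hab : a ^ 2 + b ^ 2 = 1) :
    ∃ T : Diffeomorph (𝓡 (n + 1)) (𝓡 (n + 1)) (UnitSphere (n + 1)) (UnitSphere (n + 1)) ∞,
      IsConformalTransformation T ∧
      (∀ p, T (cliffordTorus hn hab p) ∈ openHemisphere n) ∧
      ∃ f : UnitSphere 2 × UnitSphere (n - 2) → LorentzSpace n,
        (∀ p, f p = hemisphereToHyperbolic (T (cliffordTorus hn hab p))) ∧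
        IsSmoothImmersion ((𝓡 2).prod (𝓡 (n - 2))) f ∧
        (∃ ν : UnitSphere 2 × UnitSphere (n - 2) → LorentzSpace n,
          IsUnitNormalField ((𝓡 2).prod (𝓡 (n - 2))) f ν) ∧
        ∀ ν : UnitSphere 2 × UnitSphere (n - 2) → LorentzSpace n,
          IsUnitNormalField ((𝓡 2).prod (𝓡 (n - 2))) f ν →
            IsSpacelikeFront ((𝓡 2).prod (𝓡 (n - 2)))
              (fun p => (1 / Real.sqrt 2) • (f p - ν p)) ∧
            ¬ IsSmoothImmersion ((𝓡 2).prod (𝓡 (n - 2)))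
              (fun p => (1 / Real.sqrt 2) • (f p - ν p)) := by
  set J := (𝓡 2).prod (𝓡 (n - 2))
  -- Any value of `q * a` above `1` would push the torus into the hemisphere; `2` is a convenient
  -- one.
  obtain ⟨q, hq, hqa⟩ : ∃ q : ℝ, 0 < q ∧ q * a = 2 :=
    ⟨2 / a, by positivity, div_mul_cancel₀ _ ha.ne'⟩
  obtain ⟨μ, hμ0, hμ⟩ : ∃ μ : ℝ, 0 ≤ μ ∧ q ^ 2 = 1 + μ ^ 2 := by
    refine ⟨Real.sqrt (q ^ 2 - 1), Real.sqrt_nonneg _, ?_⟩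
    have h1 : (q * a) ^ 2 = 4 := by rw [hqa]; norm_num
    have h2 : q ^ 2 = 4 + (q * b) ^ 2 := by linear_combination h1 - q ^ 2 * hab
    rw [Real.sq_sqrt (by nlinarith [sq_nonneg (q * b)])]
    ring
  have he : ‖EuclideanSpace.single (Fin.last (n + 1)) (1 : ℝ)‖ = 1 := by simp
  have hS := boosted_clifford_last_pos hn hab hb hq hμ0 hμ hqa
  have hS0 := fun p => (hS p).ne'
  have h1 := norm_cliffordMap hn hab
  have h2 : ∀ p, ‖cliffordMap n (-b) a p‖ = 1 :=
    norm_cliffordMap hn (by rw [neg_sq, add_comm, hab])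
  have hX := isSmoothImmersion_cliffordMap hn ha.ne' hb.ne'
  set f := boostedHypersurface μ q (cliffordMap n a b) with hf_def
  set ν₀ := boostedNormal μ q (cliffordMap n a b) (cliffordMap n (-b) a) with hν_def
  have hf : IsSmoothImmersion J f := isSmoothImmersion_boostedHypersurface hμ hX h1 hS0
  have hfH : ∀ p, f p ∈ hyperbolicSpace n := boostedHypersurface_mem hq hμ h1 hS
  have hν₀ : IsUnitNormalField J f ν₀ :=
    isUnitNormalField_boostedNormal hμ hX.1 (contMDiff_cliffordMap (-b) a) h1 h2
      (inner_cliffordMap_normal hn a b) (inner_differential_cliffordMap_normal hn a b) hS0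
  have hdim : Module.finrank ℝ (EuclideanSpace ℝ (Fin 2) × EuclideanSpace ℝ (Fin (n - 2))) = n := by
    rw [Module.finrank_prod, finrank_euclideanSpace_fin, finrank_euclideanSpace_fin]
    omega
  refine ⟨sphereBoostDiffeomorph hq hμ he, isConformalTransformation_sphereBoost hq hμ he,
    fun p => ?_, f, fun p => boostedHypersurface_eq_hemisphereToHyperbolic hq hμ (h1 p) (hS0 p) rfl,
    hf, ⟨ν₀, hν₀⟩, fun ν hν => ⟨hν.isSpacelikeFront hdim hf hfH, ?_⟩⟩
  · refine (mul_pos (inv_pos.2 (boost_denominator_last_pos hq hμ (h1 p))) (hS p)).trans_eq ?_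
    exact (sphereBoost_last μ q _).symm
  · have := preconnectedSpace_unitSphere (k := 2) two_pos
    have := preconnectedSpace_unitSphere (k := n - 2) (by omega)
    -- The sign of the given normal decides on which slice `x` collapses.
    obtain ⟨ε, hε, hνε⟩ : ∃ ε : ℝ, ε ^ 2 = 1 ∧ ∀ p, ν p = ε • ν₀ p := by
      rcases hν₀.eq_or_eq_neg hdim hf hfH hν with h | h
      · exact ⟨1, by norm_num, fun p => by rw [h, one_smul]⟩
      · exact ⟨-1, by norm_num, fun p => by rw [h, neg_one_smul]⟩
    obtain ⟨v, hv⟩ := exists_slice hn hab hq hμ hε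
    obtain ⟨u₀, -⟩ := exists_unitSphere_last_eq (k := 2) (y := 0) two_pos (by norm_num)
    have : Nonempty (UnitSphere 2) := ⟨u₀⟩
    refine not_isSmoothImmersion_of_sub_slice_const (v := v) fun u u' => ?_
    have hSv := hS0 (u₀, v)
    rw [cliffordMap, cliffordVector_last hn] at hSv
    rw [hνε, hνε, boostedHypersurface_sub_boostedNormal_slice hn hab hε hv hSv u u']
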